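/- **Proposition 3.5.** Let $K$ be a finite simplicial complex and let $f\colon K\to\mathbb R$ be a discrete Morse function: for every simplex $\sigma$ of dimension $p$, $$\#\{\tau^{(p+1)}\succ\sigma \mid f(\tau)\le f(\sigma)\}\le 1\quad\text{and}\quad \#\{\nu^{(p-1)}\prec\sigma \mid f(\sigma)\le f(\nu)\}\le 1,$$ where $\prec$ means "is a face of" and the superscript is the dimension. A simplex $\sigma$ is called *$f$-critical* if both of these sets are empty. Assume that $f$ is excellent, that is, distinct critical simplices have distinct values, and that no non-critical simplex has the same value as a critical simplex. For $c\in\mathbb R$ let $K(c)$ be the subcomplex of all simplices with $f$-value at most $c$ together with all their faces, and let $K(<c)$ be the subcomplex of all simplices with $f$-value less than $c$ together with all their faces; thus, if $c_1<\dots<c_n$ are the values of $f$, then $K(<c_i)=K(c_{i-1})$, with $K(c_0)=\varnothing$. Homology is simplicial homology with coefficients in a fixed field, and all maps between homology groups below are induced by inclusions. Let $\sigma,\tau\in K$. A homology class $h\in H_p(K(f(\sigma)))$ is *born at $\sigma$* if it is not in the image of $H_p(K(<f(\sigma)))$. It *dies at $\tau$* (by the elder rule) if $f(\sigma)<f(\tau)$,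 the image of $h$ in $H_p(K(<f(\tau)))$ is not in the image of $H_p(K(<f(\sigma)))$, and the image of $h$ in $H_p(K(f(\tau)))$ is in the image of $H_p(K(<f(\sigma)))$. The pair $(\sigma,\tau)$ is a *persistence pair* of $f$ if, for some $p\ge 0$, some class $h\in H_p(K(f(\sigma)))$ is born at $\sigma$ and dies at $\tau$. If $(\sigma^{(q)},\tau^{(q+1)})$ is a persistence pair of $f$, with $\dim\sigma=q$ and $\dim\tau=q+1$, then both $\sigma$ and $\tau$ are $f$-critical. -/

import Mathlib

/-! Discrete Morse functions on finite simplicial complexes, simplicial homology with coefficients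
in a field, and persistence pairs.

A simplex is a nonempty finite set of vertices; a simplex of dimension `p` has `p + 1` vertices. -/

namespace DiscreteMorse

section MorseFunctions

variable {V : Type*} {K : PreAbstractSimplicialComplex V}

/-- `IsFacet α β`: the simplex `α` is a face of `β` and `dim β = dim α + 1`. -/
def IsFacet (α β : K) : Prop :=
  (α : Finset V) ⊆ β ∧ (β : Finset V).card = (α : Finset V).card + 1

/-- The set of simplices `τ` having `σ` as a face of codimension one, with `f τ ≤ f σ`. -/
def upSet (f : K → ℝ) (σ : K) : Set K := {τ | IsFacet σ τ ∧ f τ ≤ f σ}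

/-- The set of faces `ν` of `σ` of codimension one, with `f σ ≤ f ν`. -/
def downSet (f : K → ℝ) (σ : K) : Set K := {ν | IsFacet ν σ ∧ f σ ≤ f ν}

/-- Discrete Morse functions (in the sense of Forman). -/
def IsDiscreteMorse (f : K → ℝ) : Prop :=
  ∀ σ : K, (upSet f σ).encard ≤ 1 ∧ (downSet f σ).encard ≤ 1

/-- Critical simplices of `f`. -/
def IsCritical (f : K → ℝ) (σ : K) : Prop :=
  (upSet f σ).encard = 0 ∧ (downSet f σ).encard = 0

/-- A function is excellent if distinct critical simplices have distinct values. -/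
def IsExcellent (f : K → ℝ) : Prop :=
  ∀ σ τ : K, IsCritical f σ → IsCritical f τ → f σ = f τ → σ = τ

/-- The subcomplex of `K` generated by a set of simplices: these simplices and all their faces. -/
def generated (S : Set K) : PreAbstractSimplicialComplex V where
  faces := {τ | τ.Nonempty ∧ ∃ σ ∈ S, τ ⊆ (σ : Finset V)}
  isRelLowerSet_faces := by
    rintro τ ⟨hτ, σ, hσ, h⟩
    exact ⟨hτ, fun ρ hρ hne => ⟨hne, σ, hσ, hρ.trans h⟩⟩

/-- The sublevel complex `K(c)`: all simplices with value at most `c`, and their faces. -/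
def sublevel (f : K → ℝ) (c : ℝ) : PreAbstractSimplicialComplex V :=
  generated {σ : K | f σ ≤ c}

/-- The complex that precedes `K(c)`: all simplices with value less than `c`, and their faces.
If `K` is finite, `c₁ < ⋯ < cₙ` are the values of `f` and `c = cᵢ`, then this is `K(cᵢ₋₁)`
(the empty complex if `i = 1`). -/
def preSublevel (f : K → ℝ) (c : ℝ) : PreAbstractSimplicialComplex V :=
  generated {σ : K | f σ < c}

theorem generated_mono {S T : Set K} (h : S ⊆ T) : generated S ≤ generated T := by
  rintro τ ⟨hτ, σ, hσ, hs⟩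
  exact ⟨hτ, σ, h hσ, hs⟩

theorem preSublevel_le_sublevel (f : K → ℝ) (c : ℝ) : preSublevel f c ≤ sublevel f c :=
  generated_mono fun σ (hσ : f σ < c) => hσ.le

theorem sublevel_le_preSublevel (f : K → ℝ) {c d : ℝ} (h : c < d) :
    sublevel f c ≤ preSublevel f d :=
  generated_mono fun σ (hσ : f σ ≤ c) => lt_of_le_of_lt hσ h

end MorseFunctions

section Subquotients

variable {R M : Type*} [Ring R] [AddCommGroup M] [Module R M]

/-- The quotient `A / (A ∩ B)` for submodules `A`, `B` of a module; it is `A / B` if `B ≤ A`. -/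
def Subquotient (A B : Submodule R M) : Type _ := A ⧸ B.submoduleOf A

instance (A B : Submodule R M) : AddCommGroup (Subquotient A B) :=
  inferInstanceAs (AddCommGroup (A ⧸ B.submoduleOf A))

instance (A B : Submodule R M) : Module R (Subquotient A B) :=
  inferInstanceAs (Module R (A ⧸ B.submoduleOf A))

/-- The map `A / B → A' / B'`, `[a] ↦ [a]`, for `A ≤ A'` and `B ≤ B'`. -/
def Subquotient.map {A A' B B' : Submodule R M} (hA : A ≤ A') (hB : B ≤ B') :
    Subquotient A B →ₗ[R] Subquotient A' B' :=
  Submodule.mapQ (B.submoduleOf A) (B'.submoduleOf A') (Submodule.inclusion hA)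
    fun z (hz : (z : M) ∈ B) => (hB hz : (z : M) ∈ B')

end Subquotients

section Homology

variable (𝔽 : Type*) [Field 𝔽] {V : Type*}

/-- The space `C_q(L)` of simplicial `q`-chains of `L`. -/
def chains (L : PreAbstractSimplicialComplex V) (q : ℕ) : Submodule 𝔽 (Finset V →₀ 𝔽) :=
  Finsupp.supported 𝔽 𝔽 {σ : Finset V | σ ∈ L ∧ σ.card = q + 1}

theorem chains_mono {L M : PreAbstractSimplicialComplex V} (h : L ≤ M) (q : ℕ) :
    chains 𝔽 L q ≤ chains 𝔽 M q :=
  Finsupp.supported_mono fun _ hσ => ⟨h hσ.1, hσ.2⟩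

variable [LinearOrder V]

/-- The simplicial boundary operator, on formal linear combinations of finite vertex sets.
Simplices are oriented by the order of the vertices: the boundary of `[v₀ < ⋯ < v_q]` is
`∑ i, (-1) ^ i [v₀, …, v_{i-1}, v_{i+1}, …, v_q]` if `1 ≤ q`, and zero if `q = 0`. -/
noncomputable def boundary : (Finset V →₀ 𝔽) →ₗ[𝔽] (Finset V →₀ 𝔽) :=
  Finsupp.linearCombination 𝔽 fun σ : Finset V =>
    if σ.card ≤ 1 then 0
    else ∑ v ∈ σ, Finsupp.single (σ.erase v) ((-1 : 𝔽) ^ (σ.filter (· < v)).card)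

/-- The space `Z_q(L)` of `q`-cycles of `L`. -/
noncomputable def cycles (L : PreAbstractSimplicialComplex V) (q : ℕ) :
    Submodule 𝔽 (Finset V →₀ 𝔽) :=
  chains 𝔽 L q ⊓ LinearMap.ker (boundary 𝔽)

/-- The space `B_q(L)` of `q`-boundaries of `L`. -/
noncomputable def boundaries (L : PreAbstractSimplicialComplex V) (q : ℕ) :
    Submodule 𝔽 (Finset V →₀ 𝔽) :=
  (chains 𝔽 L (q + 1)).map (boundary 𝔽)

/-- The homology group `H_q(L) = Z_q(L) / B_q(L)`. -/
abbrev Homology (L : PreAbstractSimplicialComplex V) (q : ℕ) : Type _ :=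
  Subquotient (cycles 𝔽 L q) (boundaries 𝔽 L q)

variable {L M : PreAbstractSimplicialComplex V}

theorem cycles_mono (h : L ≤ M) (q : ℕ) : cycles 𝔽 L q ≤ cycles 𝔽 M q :=
  inf_le_inf_right _ (chains_mono 𝔽 h q)

/-- The map `H_q(L) → H_q(M)` induced by the inclusion of a subcomplex `L` of `M`. -/
noncomputable def homologyMap (h : L ≤ M) (q : ℕ) : Homology 𝔽 L q →ₗ[𝔽] Homology 𝔽 M q :=
  Subquotient.map (cycles_mono 𝔽 h q) (Submodule.map_mono (chains_mono 𝔽 h (q + 1)))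

end Homology

section Persistence

variable {𝔽 : Type*} [Field 𝔽] {V : Type*} [LinearOrder V] {K : PreAbstractSimplicialComplex V}

/-- A homology class `h` of `K(σ) = K(f σ)` is born at `σ` if it is not in the image of the
homology of the preceding complex of the filtration. -/
def IsBornAt (f : K → ℝ) (σ : K) {q : ℕ} (h : Homology 𝔽 (sublevel f (f σ)) q) : Prop :=
  h ∉ LinearMap.range (homologyMap 𝔽 (preSublevel_le_sublevel f (f σ)) q)

/-- Death at `τ`, with the elder rule, of a homology class `h` born at `σ`: in `K(τ)`, but not yet
in the complex preceding `K(τ)`, the class `h` becomes zero or merges with an older class, that is,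
with one that comes from the complex preceding `K(σ)`. -/
def DiesAt (f : K → ℝ) {σ : K} {q : ℕ} (h : Homology 𝔽 (sublevel f (f σ)) q) (τ : K) : Prop :=
  ∃ hlt : f σ < f τ,
    homologyMap 𝔽 (sublevel_le_preSublevel f hlt) q h ∉
      LinearMap.range (homologyMap 𝔽
        ((preSublevel_le_sublevel f (f σ)).trans (sublevel_le_preSublevel f hlt)) q) ∧
    homologyMap 𝔽
        ((sublevel_le_preSublevel f hlt).trans (preSublevel_le_sublevel f (f τ))) q h ∈
      LinearMap.range (homologyMap 𝔽
        ((preSublevel_le_sublevel f (f σ)).trans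
          ((sublevel_le_preSublevel f hlt).trans (preSublevel_le_sublevel f (f τ)))) q)

variable (𝔽) in
/-- `(σ, τ)` is a persistence pair of `f` if some homology class (of some degree) is born at `σ`
and dies at `τ`. -/
def IsPersistencePair (f : K → ℝ) (σ τ : K) : Prop :=
  ∃ (p : ℕ) (h : Homology 𝔽 (sublevel f (f σ)) p), IsBornAt f σ h ∧ DiesAt f h τ

end Persistence

end DiscreteMorse

namespace DiscreteMorse

/-! ### Chains and collapses -/

section Chains

variable {𝔽 : Type*} [Field 𝔽] {V : Type*}

/-! If no critical simplex has value `c`, passing from `K(<c)` to `K(c)` does not change homology.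
By the Morse condition, the new simplices come in pairs, a face and a coface of value `c`, and all
other codimension-one faces of the coface already lie in `K(<c)`
(`IsDiscreteMorse.exists_isCollapse`). Such simultaneous collapses induce isomorphisms on homology
(`IsCollapse.homologyMap_surjective`, `IsCollapse.homologyMap_injective`). A birth at `σ`
contradicts surjectivity at `f σ`, and a death at `τ` contradicts injectivity at `f τ`; so both
values are critical. Since noncritical simplices avoid critical values, `σ` and `τ` are critical. -/

theorem mem_chains_iff {L : PreAbstractSimplicialComplex V} {n : ℕ} {w : Finset V →₀ 𝔽} :
    w ∈ chains 𝔽 L n ↔ ∀ β, w β ≠ 0 → β ∈ L ∧ β.card = n + 1 := by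
  rw [chains, Finsupp.mem_supported]
  simp [Set.subset_def]

/-- A family of simultaneous elementary collapses of `M` onto `L`: the simplices of `M` outside `L`
come in pairs `(ν, a ν)`, with `ν` satisfying `P`, and `ν` is the only face of codimension one of
`a ν` that is not in `L`. -/
structure IsCollapse (L M : PreAbstractSimplicialComplex V) (P : Finset V → Prop)
    (a : Finset V → Finset V) : Prop where
  notMem : ∀ ν, P ν → ν ∉ L
  nonempty : ∀ ν, P ν → ν.Nonempty
  mem : ∀ ν, P ν → a ν ∈ M
  subset : ∀ ν, P ν → ν ⊆ a ν
  card_eq : ∀ ν, P ν → (a ν).card = ν.card + 1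
  facet_mem : ∀ ν, P ν → ∀ ρ : Finset V, ρ.Nonempty → ρ ⊆ a ν → ρ.card = ν.card → ρ ≠ ν → ρ ∈ L
  cover : ∀ ν ∈ M, ν ∉ L → P ν ∨ ∃ μ, P μ ∧ a μ = ν

end Chains

/-! ### The boundary operator and its square -/

section Boundary

variable {𝔽 : Type*} [Field 𝔽] {V : Type*} [LinearOrder V]

theorem boundary_single (σ : Finset V) :
    boundary 𝔽 (Finsupp.single σ 1) = if σ.card ≤ 1 then 0
      else ∑ v ∈ σ, Finsupp.single (σ.erase v) ((-1 : 𝔽) ^ (σ.filter (· < v)).card) := by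
  rw [boundary, Finsupp.linearCombination_single, one_smul]

theorem boundary_apply (w : Finset V →₀ 𝔽) (μ : Finset V) :
    boundary 𝔽 w μ = ∑ β ∈ w.support, w β * boundary 𝔽 (Finsupp.single β 1) μ := by
  conv_lhs => rw [boundary, Finsupp.linearCombination_apply, Finsupp.sum, Finsupp.finsetSum_apply]
  simp only [boundary_single, Finsupp.smul_apply, smul_eq_mul]

theorem exists_eq_erase_of_boundary_single_ne_zero {β μ : Finset V}
    (h : boundary 𝔽 (Finsupp.single β 1) μ ≠ 0) : 1 < β.card ∧ ∃ v ∈ β, β.erase v = μ := by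
  rw [boundary_single] at h
  split_ifs at h with hc
  · simp at h
  · refine ⟨by omega, ?_⟩
    rw [Finsupp.finsetSum_apply] at h
    obtain ⟨v, hv, hne⟩ := Finset.exists_ne_zero_of_sum_ne_zero h
    exact ⟨v, hv, by by_contra hvμ; exact hne (Finsupp.single_eq_of_ne' hvμ)⟩

theorem boundary_single_erase_ne_zero {β : Finset V} (hβ : 1 < β.card) {v : V} (hv : v ∈ β) :
    boundary 𝔽 (Finsupp.single β 1) (β.erase v) ≠ 0 := by
  rw [boundary_single, if_neg (by omega), Finsupp.finsetSum_apply, Finset.sum_eq_single v]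
  · rw [Finsupp.single_eq_same]
    exact pow_ne_zero _ (neg_ne_zero.mpr one_ne_zero)
  · intro u hu huv
    refine Finsupp.single_eq_of_ne' fun h => huv ?_
    by_contra
    have : u ∈ β.erase v := Finset.mem_erase.mpr ⟨huv, hu⟩
    rw [← h] at this
    simp at this
  · exact fun h => absurd hv h

theorem subset_and_card_of_boundary_single_ne_zero {β μ : Finset V}
    (h : boundary 𝔽 (Finsupp.single β 1) μ ≠ 0) :
    μ.Nonempty ∧ μ ⊆ β ∧ β.card = μ.card + 1 := by
  obtain ⟨hc, v, hv, rfl⟩ := exists_eq_erase_of_boundary_single_ne_zero h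
  have := Finset.card_erase_add_one hv
  exact ⟨Finset.card_pos.mp (by omega), Finset.erase_subset _ _, this.symm⟩

theorem boundary_single_ne_zero {β μ : Finset V} (hμ : μ.Nonempty) (hsub : μ ⊆ β)
    (hc : β.card = μ.card + 1) : boundary 𝔽 (Finsupp.single β 1) μ ≠ 0 := by
  have hpos := hμ.card_pos
  have hd : (β \ μ).card = 1 := by rw [Finset.card_sdiff_of_subset hsub]; omega
  obtain ⟨v, hv⟩ := Finset.card_eq_one.mp hd
  have hvβ : v ∈ β := (Finset.mem_sdiff.mp (hv ▸ Finset.mem_singleton_self v)).1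
  have : β.erase v = μ := by
    rw [← Finset.sdiff_singleton_eq_erase, ← hv, Finset.sdiff_sdiff_eq_self hsub]
  rw [← this]
  exact boundary_single_erase_ne_zero (by omega) hvβ

theorem card_filter_erase_of_lt {σ : Finset V} {v w : V} (h : w < v) (hw : w ∈ σ) :
    (σ.filter (· < v)).card = ((σ.erase w).filter (· < v)).card + 1 := by
  rw [Finset.filter_erase, Finset.card_erase_add_one]
  exact Finset.mem_filter.mpr ⟨hw, h⟩

theorem filter_erase_of_lt {σ : Finset V} {v w : V} (h : w < v) :
    (σ.erase v).filter (· < w) = σ.filter (· < w) := by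
  rw [Finset.filter_erase, Finset.erase_eq_of_notMem]
  simp [h.le]

theorem boundary_boundary_single (σ : Finset V) :
    boundary 𝔽 (boundary 𝔽 (Finsupp.single σ 1)) = 0 := by
  rw [boundary_single]
  split_ifs with hc
  · simp
  rw [map_sum]
  have key : ∀ v ∈ σ, boundary 𝔽 (Finsupp.single (σ.erase v)
      ((-1 : 𝔽) ^ (σ.filter (· < v)).card)) = (-1 : 𝔽) ^ (σ.filter (· < v)).card •
        if σ.card ≤ 2 then 0 else ∑ w ∈ σ.erase v, Finsupp.single ((σ.erase v).erase w)
          ((-1 : 𝔽) ^ ((σ.erase v).filter (· < w)).card) := by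
    intro v hv
    have h := Finset.card_erase_add_one hv
    rw [← mul_one ((-1 : 𝔽) ^ _), ← smul_eq_mul, ← Finsupp.smul_single, map_smul, boundary_single]
    have hiff : (σ.erase v).card ≤ 1 ↔ σ.card ≤ 2 := by omega
    simp only [hiff, smul_eq_mul, mul_one]
  rw [Finset.sum_congr rfl key]
  -- The faces of an edge are vertices, whose boundary is zero by convention.
  by_cases h2 : σ.card ≤ 2
  · simp [h2]
  simp only [if_neg h2, Finset.smul_sum, Finsupp.smul_single, smul_eq_mul, ← pow_add]
  rw [Finset.sum_sigma']
  -- Erasing `w` first lowers the position of `v` by one, while erasing `v` first leaves that of `w`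
  -- unchanged; so the two orders of erasure have opposite signs.
  have anti : ∀ v ∈ σ, ∀ w ∈ σ, w < v →
      Finsupp.single ((σ.erase v).erase w) ((-1 : 𝔽) ^ ((σ.filter (· < v)).card +
        ((σ.erase v).filter (· < w)).card)) +
      Finsupp.single ((σ.erase w).erase v) ((-1 : 𝔽) ^ ((σ.filter (· < w)).card +
        ((σ.erase w).filter (· < v)).card)) = 0 := by
    intro v _ w hw h
    rw [Finset.erase_right_comm, ← Finsupp.single_add, card_filter_erase_of_lt h hw,
      filter_erase_of_lt h]
    have hsign (a b : ℕ) : (-1 : 𝔽) ^ (a + 1 + b) + (-1) ^ (b + a) = 0 := by ring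
    rw [hsign, Finsupp.single_zero]
  refine Finset.sum_involution (fun x _ => ⟨x.2, x.1⟩) ?_ ?_ ?_ ?_
  · rintro ⟨v, w⟩ h
    obtain ⟨hv, hwv, hw⟩ : v ∈ σ ∧ w ≠ v ∧ w ∈ σ := by simpa using h
    rcases lt_or_gt_of_ne hwv with h | h
    · exact anti v hv w hw h
    · rw [add_comm]
      exact anti w hw v hv h
  · rintro ⟨v, w⟩ h _ heq
    obtain ⟨hv, hwv, hw⟩ : v ∈ σ ∧ w ≠ v ∧ w ∈ σ := by simpa using h
    exact hwv (congrArg Sigma.fst heq)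
  · rintro ⟨v, w⟩ h
    obtain ⟨hv, hwv, hw⟩ : v ∈ σ ∧ w ≠ v ∧ w ∈ σ := by simpa using h
    simpa using ⟨hw, hwv.symm, hv⟩
  · intros
    rfl

theorem boundary_boundary (w : Finset V →₀ 𝔽) : boundary 𝔽 (boundary 𝔽 w) = 0 := by
  have : boundary 𝔽 ∘ₗ boundary 𝔽 = (0 : (Finset V →₀ 𝔽) →ₗ[𝔽] (Finset V →₀ 𝔽)) := by
    ext σ : 2
    simpa using boundary_boundary_single (𝔽 := 𝔽) σ
  exact LinearMap.congr_fun this w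

theorem mem_of_boundary_ne_zero {L : PreAbstractSimplicialComplex V} {n : ℕ} {w : Finset V →₀ 𝔽}
    (hw : w ∈ chains 𝔽 L n) {μ : Finset V} (h : boundary 𝔽 w μ ≠ 0) : μ ∈ L ∧ μ.card = n := by
  rw [boundary_apply] at h
  obtain ⟨β, hβ, hne⟩ := Finset.exists_ne_zero_of_sum_ne_zero h
  obtain ⟨hβL, hβc⟩ := mem_chains_iff.mp hw β (left_ne_zero_of_mul hne)
  obtain ⟨hμ, hsub, hc⟩ := subset_and_card_of_boundary_single_ne_zero (right_ne_zero_of_mul hne)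
  exact ⟨(L.isRelLowerSet_faces hβL).2 hsub hμ, by omega⟩

/-! ### Invariance of homology under collapses -/

variable {L M : PreAbstractSimplicialComplex V} {P : Finset V → Prop} {a : Finset V → Finset V}

theorem IsCollapse.eq_of_boundary_single_ne_zero (h : IsCollapse L M P a) {ν μ : Finset V}
    (hν : P ν) (hμ : μ ∉ L) (hne : boundary 𝔽 (Finsupp.single (a ν) 1) μ ≠ 0) : μ = ν := by
  obtain ⟨h0, hsub, hc⟩ := subset_and_card_of_boundary_single_ne_zero hne
  by_contra hμν
  have := h.card_eq ν hν
  exact hμ (h.facet_mem ν hν μ h0 hsub (by omega) hμν)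

open Classical in
-- Modulo chains of `L`, the boundary of `a ν` is a nonzero multiple of `ν` alone, so the
-- coefficients at the various `ν` can be prescribed independently by scaling each `a ν`.
theorem IsCollapse.exists_chain_eq (h : IsCollapse L M P a) {n : ℕ} {w : Finset V →₀ 𝔽}
    (hw : w ∈ chains 𝔽 M n) :
    ∃ u ∈ chains 𝔽 M (n + 1), ∀ ν, P ν → boundary 𝔽 u ν = w ν := by
  let g : Finset V → (Finset V →₀ 𝔽) := fun ν =>
    if P ν then Finsupp.single (a ν) (boundary 𝔽 (Finsupp.single (a ν) 1) ν)⁻¹ else 0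
  refine ⟨∑ ν ∈ w.support, w ν • g ν, ?_, ?_⟩
  · refine Submodule.sum_mem _ fun ν hν => Submodule.smul_mem _ _ ?_
    simp only [g]
    split_ifs with hP
    · have := (mem_chains_iff.mp hw ν (Finsupp.mem_support_iff.mp hν)).2
      refine Finsupp.single_mem_supported 𝔽 _ ⟨h.mem ν hP, ?_⟩
      rw [h.card_eq ν hP, this]
    · exact Submodule.zero_mem _
  · intro μ hμ
    have hg : ∀ ν, boundary 𝔽 (g ν) μ = if ν = μ then 1 else 0 := by
      intro ν
      simp only [g]
      by_cases hP : P ν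
      · rw [if_pos hP, ← mul_one (_⁻¹), ← smul_eq_mul, ← Finsupp.smul_single, map_smul,
          Finsupp.smul_apply, smul_eq_mul]
        split_ifs with hνμ
        · subst hνμ
          exact inv_mul_cancel₀
            (boundary_single_ne_zero (h.nonempty ν hP) (h.subset ν hP) (h.card_eq ν hP))
        · by_contra hne
          exact hνμ (h.eq_of_boundary_single_ne_zero hP (h.notMem μ hμ)
            (right_ne_zero_of_mul hne)).symm
      · rw [if_neg hP, map_zero, if_neg (by rintro rfl; exact hP hμ)]
        rfl
    simp only [map_sum, map_smul, Finsupp.finsetSum_apply, Finsupp.smul_apply, smul_eq_mul, hg,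
      mul_ite, mul_one, mul_zero, Finset.sum_ite_eq']
    split_ifs with hs
    · rfl
    · exact (Finsupp.notMem_support_iff.mp hs).symm

/-- The only simplices outside `L` that can occur in `y` are the `a μ`. Among these only `a μ`
itself has `μ` in its boundary, so nothing cancels `μ` there, although `μ` is not in `L`. -/
theorem IsCollapse.mem_chains (h : IsCollapse L M P a) {n : ℕ} {y : Finset V →₀ 𝔽}
    (hy : y ∈ chains 𝔽 M n) (hP : ∀ ν, P ν → y ν = 0)
    (hb : ∀ μ, boundary 𝔽 y μ ≠ 0 → μ ∈ L) : y ∈ chains 𝔽 L n := by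
  have cover : ∀ β, y β ≠ 0 → β ∉ L → ∃ μ, P μ ∧ a μ = β := fun β hβ hL =>
    (h.cover β (mem_chains_iff.mp hy β hβ).1 hL).resolve_left fun hPβ => hβ (hP β hPβ)
  refine mem_chains_iff.mpr fun β hβ => ⟨?_, (mem_chains_iff.mp hy β hβ).2⟩
  by_contra hL
  obtain ⟨μ, hμ, rfl⟩ := cover β hβ hL
  refine h.notMem μ hμ (hb μ ?_)
  rw [boundary_apply, Finset.sum_eq_single (a μ)]
  · exact mul_ne_zero hβ
      (boundary_single_ne_zero (h.nonempty μ hμ) (h.subset μ hμ) (h.card_eq μ hμ))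
  · intro γ hγ hne
    by_contra hmul
    have hinc := right_ne_zero_of_mul hmul
    obtain ⟨h0, hsub, -⟩ := subset_and_card_of_boundary_single_ne_zero hinc
    obtain ⟨ν, hν, rfl⟩ := cover γ (Finsupp.mem_support_iff.mp hγ) fun hγL =>
      h.notMem μ hμ ((L.isRelLowerSet_faces hγL).2 hsub h0)
    exact hne (h.eq_of_boundary_single_ne_zero hν (h.notMem μ hμ) hinc ▸ rfl)
  · exact fun hs => absurd (Finsupp.mem_support_iff.mpr hβ) hs

/-- Used twice: for a cycle of `M` it gives surjectivity on homology, and for a chain of `M`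
bounding a cycle of `L` it gives injectivity. -/
theorem IsCollapse.exists_sub_boundary_mem (h : IsCollapse L M P a) {n : ℕ} {w : Finset V →₀ 𝔽}
    (hw : w ∈ chains 𝔽 M n) (hb : ∀ μ, boundary 𝔽 w μ ≠ 0 → μ ∈ L) :
    ∃ u ∈ chains 𝔽 M (n + 1), w - boundary 𝔽 u ∈ chains 𝔽 L n := by
  obtain ⟨u, hu, huw⟩ := h.exists_chain_eq hw
  refine ⟨u, hu, h.mem_chains (Submodule.sub_mem _ hw (mem_chains_iff.mpr fun μ hμ => ?_))
    (fun ν hν => by rw [Finsupp.sub_apply, huw ν hν, sub_self]) fun μ hμ => hb μ ?_⟩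
  · exact mem_of_boundary_ne_zero hu hμ
  · rwa [map_sub, boundary_boundary, sub_zero] at hμ

theorem homologyMap_mk (hLM : L ≤ M) {q : ℕ} (z : cycles 𝔽 L q) :
    homologyMap 𝔽 hLM q (Submodule.Quotient.mk z) =
      Submodule.Quotient.mk (Submodule.inclusion (cycles_mono 𝔽 hLM q) z) := rfl

theorem homology_mk_eq_zero {q : ℕ} (z : cycles 𝔽 L q) :
    (Submodule.Quotient.mk z : Homology 𝔽 L q) = 0 ↔
      (z : Finset V →₀ 𝔽) ∈ boundaries 𝔽 L q :=
  Submodule.Quotient.mk_eq_zero _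

theorem homologyMap_comp {N : PreAbstractSimplicialComplex V} (hLM : L ≤ M) (hMN : M ≤ N) (q : ℕ)
    (x : Homology 𝔽 L q) :
    homologyMap 𝔽 hMN q (homologyMap 𝔽 hLM q x) = homologyMap 𝔽 (hLM.trans hMN) q x := by
  obtain ⟨z, rfl⟩ := Submodule.Quotient.mk_surjective _ x
  rfl

theorem IsCollapse.homologyMap_surjective (h : IsCollapse L M P a) (hLM : L ≤ M) (q : ℕ) :
    Function.Surjective (homologyMap 𝔽 hLM q) := by
  intro x
  obtain ⟨⟨z, hz, hbz⟩, rfl⟩ := Submodule.Quotient.mk_surjective _ x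
  have hbz' : boundary 𝔽 z = 0 := hbz
  obtain ⟨u, hu, hzu⟩ := h.exists_sub_boundary_mem hz fun μ hμ => by simp [hbz'] at hμ
  refine ⟨Submodule.Quotient.mk ⟨z - boundary 𝔽 u, hzu, ?_⟩, ?_⟩
  · change boundary 𝔽 (z - boundary 𝔽 u) = 0
    rw [map_sub, boundary_boundary, hbz', sub_zero]
  · rw [homologyMap_mk]
    refine (Submodule.Quotient.eq _).mpr ?_
    change z - boundary 𝔽 u - z ∈ boundaries 𝔽 M q
    rw [sub_sub_cancel_left]
    exact Submodule.neg_mem _ (Submodule.mem_map_of_mem hu)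

theorem IsCollapse.homologyMap_injective (h : IsCollapse L M P a) (hLM : L ≤ M) (q : ℕ) :
    Function.Injective (homologyMap 𝔽 hLM q) := by
  rw [injective_iff_map_eq_zero]
  intro x
  obtain ⟨⟨z, hz, hbz⟩, rfl⟩ := Submodule.Quotient.mk_surjective _ x
  rw [homologyMap_mk]
  intro h0
  obtain ⟨w, hw, hwz⟩ : z ∈ boundaries 𝔽 M q := (homology_mk_eq_zero _).mp h0
  obtain ⟨u, -, hwu⟩ := h.exists_sub_boundary_mem hw fun μ hμ =>
    (mem_chains_iff.mp hz μ (hwz ▸ hμ)).1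
  refine (homology_mk_eq_zero _).mpr ⟨_, hwu, ?_⟩
  rw [map_sub, boundary_boundary, hwz, sub_zero]

end Boundary

/-! ### Collapses of sublevel complexes -/

section Collapse

variable {V : Type*} {K : PreAbstractSimplicialComplex V} {f : K → ℝ}

theorem IsDiscreteMorse.eq_of_upSet (hf : IsDiscreteMorse f) {σ α β : K}
    (hα : IsFacet σ α) (hfα : f α ≤ f σ) (hβ : IsFacet σ β) (hfβ : f β ≤ f σ) : α = β :=
  Set.encard_le_one_iff.mp (hf σ).1 α β ⟨hα, hfα⟩ ⟨hβ, hfβ⟩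

theorem IsDiscreteMorse.eq_of_downSet (hf : IsDiscreteMorse f) {σ α β : K}
    (hα : IsFacet α σ) (hfα : f σ ≤ f α) (hβ : IsFacet β σ) (hfβ : f σ ≤ f β) : α = β :=
  Set.encard_le_one_iff.mp (hf σ).2 α β ⟨hα, hfα⟩ ⟨hβ, hfβ⟩

theorem nonempty_of_mem (σ : K) : (σ : Finset V).Nonempty :=
  (K.isRelLowerSet_faces σ.2).1

/-- Every proper coface of `σ` contains a coface of `σ` of codimension one whose value is not
larger. -/
theorem IsDiscreteMorse.exists_isFacet_le (hf : IsDiscreteMorse f) (σ : K) :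
    ∀ (n : ℕ) (ρ : K), (σ : Finset V) ⊆ ρ → (ρ : Finset V).card = (σ : Finset V).card + n + 1 →
      ∃ β : K, IsFacet σ β ∧ f β ≤ f ρ := by
  classical
  intro n
  induction n with
  | zero => exact fun ρ hsub hc => ⟨ρ, ⟨hsub, hc⟩, le_rfl⟩
  | succ n ih =>
    intro ρ hsub hc
    -- Two different facets of `ρ` contain `σ`. At most one has value at least `f ρ`, so induction
    -- applies to the other.
    have hd : 1 < ((ρ : Finset V) \ σ).card := by
      rw [Finset.card_sdiff_of_subset hsub]; omega
    obtain ⟨v, hv, w, hw, hvw⟩ := Finset.one_lt_card.mp hd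
    have face : ∀ v ∈ (ρ : Finset V) \ σ, ∃ ν : K, (ν : Finset V) = (ρ : Finset V).erase v ∧
        (σ : Finset V) ⊆ ν ∧ IsFacet ν ρ := by
      intro v hv
      obtain ⟨hvρ, hvσ⟩ := Finset.mem_sdiff.mp hv
      have hs : (σ : Finset V) ⊆ (ρ : Finset V).erase v :=
        Finset.subset_erase.mpr ⟨hsub, hvσ⟩
      exact ⟨⟨(ρ : Finset V).erase v, (K.isRelLowerSet_faces ρ.2).2 (Finset.erase_subset _ _)
        ((nonempty_of_mem σ).mono hs)⟩, rfl, hs, Finset.erase_subset _ _,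
        (Finset.card_erase_add_one hvρ).symm⟩
    obtain ⟨α, hαv, hσα, hα⟩ := face v hv
    obtain ⟨β, hβw, hσβ, hβ⟩ := face w hw
    have hne : α ≠ β := by
      rintro rfl
      have : v ∈ (ρ : Finset V).erase w :=
        Finset.mem_erase.mpr ⟨hvw, (Finset.mem_sdiff.mp hv).1⟩
      rw [← hβw, hαv] at this
      simp at this
    have step : ∀ ν : K, (σ : Finset V) ⊆ ν → IsFacet ν ρ → f ν < f ρ →
        ∃ β : K, IsFacet σ β ∧ f β ≤ f ρ := by
      intro ν hν hνρ hlt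
      obtain ⟨γ, hγ, hle⟩ := ih ν hν (by have := hνρ.2; omega)
      exact ⟨γ, hγ, hle.trans hlt.le⟩
    by_cases hlt : f α < f ρ
    · exact step α hσα hα hlt
    · refine step β hσβ hβ (lt_of_not_ge fun hge => hne ?_)
      exact hf.eq_of_downSet hα (not_lt.mp hlt) hβ hge

theorem IsDiscreteMorse.exists_isFacet_le_of_ne (hf : IsDiscreteMorse f) {σ ρ : K}
    (hsub : (σ : Finset V) ⊆ ρ) (hne : σ ≠ ρ) : ∃ β : K, IsFacet σ β ∧ f β ≤ f ρ := by
  have hlt : (σ : Finset V).card < (ρ : Finset V).card :=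
    Finset.card_lt_card (hsub.ssubset_of_ne fun h => hne (Subtype.ext h))
  exact hf.exists_isFacet_le σ ((ρ : Finset V).card - (σ : Finset V).card - 1) ρ hsub (by omega)

theorem le_of_notMem_preSublevel {c : ℝ} {σ ρ : K} (hσ : (σ : Finset V) ∉ preSublevel f c)
    (hsub : (σ : Finset V) ⊆ ρ) : c ≤ f ρ :=
  not_lt.mp fun h => hσ ⟨nonempty_of_mem σ, ρ, h, hsub⟩

/-- If `c` is not a critical value, then the sublevel complex at `c` collapses onto the complex that
precedes it. -/
theorem IsDiscreteMorse.exists_isCollapse (hf : IsDiscreteMorse f) {c : ℝ}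
    (hc : ∀ σ : K, f σ = c → ¬ IsCritical f σ) :
    ∃ P a, IsCollapse (preSublevel f c) (sublevel f c) P a := by
  classical
  -- A new `ν` has value at least `c`, so a coface `β` of value `c` lies in its `upSet` and is
  -- unique.
  let R : Finset V → Finset V → Prop := fun ν β =>
    ν ∉ preSublevel f c ∧ ∃ ν' β' : K, (ν' : Finset V) = ν ∧ (β' : Finset V) = β ∧
      IsFacet ν' β' ∧ f β' = c
  let a : Finset V → Finset V := fun ν => if h : ∃ β, R ν β then h.choose else ∅
  have ha : ∀ ν, (∃ β, R ν β) → R ν (a ν) := fun ν h => by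
    simp only [a, dif_pos h]
    exact h.choose_spec
  refine ⟨fun ν => ∃ β, R ν β, a, ?_, ?_, ?_, ?_, ?_, ?_, ?_⟩
  · rintro ν ⟨β, h, -⟩
    exact h
  · rintro ν ⟨β, -, ν', β', rfl, -⟩
    exact nonempty_of_mem ν'
  · intro ν h
    obtain ⟨-, ν', β', -, hβ, -, hfβ⟩ := ha ν h
    rw [← hβ]
    exact ⟨nonempty_of_mem β', β', hfβ.le, subset_rfl⟩
  · intro ν h
    obtain ⟨-, ν', β', rfl, hβ, hfac, -⟩ := ha ν h
    rw [← hβ]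
    exact hfac.1
  · intro ν h
    obtain ⟨-, ν', β', rfl, hβ, hfac, -⟩ := ha ν h
    rw [← hβ]
    exact hfac.2
  · intro ν h ρ hρ0 hρ hρc hne
    obtain ⟨hν, ν', β', rfl, hβ, hfac, hfβ⟩ := ha ν h
    rw [← hβ] at hρ
    let ρ' : K := ⟨ρ, (K.isRelLowerSet_faces β'.2).2 hρ hρ0⟩
    have hρβ : IsFacet ρ' β' := ⟨hρ, by rw [hfac.2]; exact congrArg (· + 1) hρc.symm⟩
    -- Otherwise `ρ` and `ν` would both lie in the `downSet` of `β'`.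
    have hlt : f ρ' < c := lt_of_not_ge fun hge => hne <| congrArg Subtype.val (hf.eq_of_downSet hρβ (hfβ.le.trans hge) hfac
      (hfβ.le.trans (le_of_notMem_preSublevel hν subset_rfl)))
    exact ⟨hρ0, ρ', hlt, subset_rfl⟩
  · rintro ν ⟨hν0, ρ, hρ, hνρ⟩ hν
    obtain ⟨σ, rfl⟩ : ∃ σ : K, (σ : Finset V) = ν :=
      ⟨⟨ν, (K.isRelLowerSet_faces ρ.2).2 hνρ hν0⟩, rfl⟩
    have low : ∀ β : K, IsFacet σ β → f β ≤ c → ∃ β, R σ β := fun β hβ hle =>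
      ⟨β, hν, σ, β, rfl, rfl, hβ, le_antisymm hle (le_of_notMem_preSublevel hν hβ.1)⟩
    by_cases hσρ : σ = ρ
    · subst hσρ
      have hσc : f σ = c := le_antisymm hρ (le_of_notMem_preSublevel hν subset_rfl)
      by_cases hup : (upSet f σ).encard = 0
      · have hdown : (downSet f σ).encard ≠ 0 := fun hdown => hc σ hσc ⟨hup, hdown⟩
        obtain ⟨μ, hμσ, hμ⟩ := Set.encard_ne_zero.mp hdown
        rw [hσc] at hμ
        -- An older coface `γ` of `μ` would yield a second element of the `upSet` of `μ` besides
        -- `σ`, with value below `c`.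
        have hμL : (μ : Finset V) ∉ preSublevel f c := by
          rintro ⟨-, γ, hγ, hμγ⟩
          have hγ' : f γ < c := hγ
          have hne : μ ≠ γ := by rintro rfl; exact not_lt.mpr hμ hγ'
          obtain ⟨β, hβ, hle⟩ := hf.exists_isFacet_le_of_ne hμγ hne
          have := hf.eq_of_upSet hβ (hle.trans (hγ'.le.trans hμ)) hμσ (hσc.le.trans hμ)
          subst this
          linarith
        have hex : ∃ β, R μ β := ⟨σ, hμL, μ, σ, rfl, rfl, hμσ, hσc⟩
        obtain ⟨-, μ', β, hμ', hβ, hfac, hfβ⟩ := ha μ hex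
        obtain rfl : μ' = μ := Subtype.ext hμ'
        refine Or.inr ⟨μ', hex, ?_⟩
        rw [← hβ]
        exact congrArg Subtype.val
          (hf.eq_of_upSet hfac (hfβ.le.trans hμ) hμσ (hσc.le.trans hμ))
      · obtain ⟨β, hβ, hle⟩ := Set.encard_ne_zero.mp hup
        exact Or.inl (low β hβ (hle.trans hσc.le))
    · obtain ⟨β, hβ, hle⟩ := hf.exists_isFacet_le_of_ne hνρ hσρ
      exact Or.inl (low β hβ (hle.trans hρ))

end Collapse

/-! ### Births and deaths -/

section Pairs

variable {𝔽 : Type*} [Field 𝔽] {V : Type*} [LinearOrder V] {K : PreAbstractSimplicialComplex V}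
  {f : K → ℝ}

/-- Homology classes are born at critical values only. -/
theorem IsDiscreteMorse.exists_isCritical_of_isBornAt (hf : IsDiscreteMorse f) {σ : K} {q : ℕ}
    {h : Homology 𝔽 (sublevel f (f σ)) q} (hb : IsBornAt f σ h) :
    ∃ ρ : K, f ρ = f σ ∧ IsCritical f ρ := by
  by_contra! hc
  obtain ⟨P, a, hcol⟩ := hf.exists_isCollapse hc
  exact hb (hcol.homologyMap_surjective _ q h)

/-- Homology classes die at critical values only. -/
theorem IsDiscreteMorse.exists_isCritical_of_diesAt (hf : IsDiscreteMorse f) {σ τ : K} {q : ℕ}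
    {h : Homology 𝔽 (sublevel f (f σ)) q} (hd : DiesAt f h τ) :
    ∃ ρ : K, f ρ = f τ ∧ IsCritical f ρ := by
  by_contra! hc
  obtain ⟨P, a, hcol⟩ := hf.exists_isCollapse hc
  obtain ⟨hlt, hnot, g, hg⟩ := hd
  -- By injectivity, the merger with the older class `g` has already happened before `τ`.
  refine hnot ⟨g, hcol.homologyMap_injective (preSublevel_le_sublevel f (f τ)) q ?_⟩
  rw [homologyMap_comp, homologyMap_comp]
  exact hg

end Pairs

end DiscreteMorse

theorem proposition3p5 {𝔽 : Type*} [Field 𝔽] {V : Type*} [LinearOrder V]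
    (K : PreAbstractSimplicialComplex V) [Finite K]
    (f : K → ℝ) (hf : DiscreteMorse.IsDiscreteMorse f) (hexc : DiscreteMorse.IsExcellent f)
    (hval : ∀ σ ρ : K, DiscreteMorse.IsCritical f σ → ¬ DiscreteMorse.IsCritical f ρ → f σ ≠ f ρ)
    (q : ℕ) (σ τ : K) (hσ : (σ : Finset V).card = q + 1) (hτ : (τ : Finset V).card = q + 2)
    (hpair : DiscreteMorse.IsPersistencePair 𝔽 f σ τ) :
    DiscreteMorse.IsCritical f σ ∧ DiscreteMorse.IsCritical f τ := by
  obtain ⟨p, h, hborn, hdies⟩ := hpair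
  obtain ⟨ρ, hρσ, hρ⟩ := hf.exists_isCritical_of_isBornAt hborn
  obtain ⟨θ, hθτ, hθ⟩ := hf.exists_isCritical_of_diesAt hdies
  exact ⟨by_contra fun h => hval ρ σ hρ h hρσ, by_contra fun h => hval θ τ hθ h hθτ⟩
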